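/- Let $d>2$ and $n\ge 1$ be integers, let $\mathbb C^n$ carry the Euclidean norm, and let $\bigotimes^d\mathbb C^n$ be the $d$-fold tensor power of $\mathbb C^n$. Let $\sigma:\bigotimes^d\mathbb C^n\to\bigotimes^d\mathbb C^n$ be the symmetrization operator, i.e. the linear map with $$\sigma(x_1\otimes\cdots\otimes x_d)=\frac1{d!}\sum_{\eta\in S_d}x_{\eta(1)}\otimes\cdots\otimes x_{\eta(d)},$$ and let $\pi$ be the projective tensor norm, $$\pi(\mathbf z)=\inf\Big\{\sum_{i=1}^r\|z_1^i\|\cdots\|z_d^i\| : r\in\mathbb N,\ \mathbf z=\sum_{i=1}^r z_1^i\otimes\cdots\otimes z_d^i\Big\}.$$ If $\mathbf w\in\bigotimes^d\mathbb C^n$ is not symmetric (that is, at least one permutation of the $d$ tensor factors does not leave $\mathbf w$ fixed), then $$\pi(\sigma(\mathbf w))<\pi(\mathbf w).$$ -/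

import Mathlib

open scoped TensorProduct

noncomputable section

/-- `⊗^d ℂ^n`, where `ℂ^n` carries the Euclidean norm. -/
abbrev Tensor (d n : ℕ) : Type :=
  PiTensorProduct ℂ (fun _ : Fin d => EuclideanSpace ℂ (Fin n))

/-- The action of a permutation on tensors:
`x₁ ⊗ ⋯ ⊗ x_d ↦ x_{η(1)} ⊗ ⋯ ⊗ x_{η(d)}`, extended linearly. -/
def permuteTensor {d n : ℕ} (η : Equiv.Perm (Fin d)) : Tensor d n →ₗ[ℂ] Tensor d n :=
  (PiTensorProduct.reindex ℂ (fun _ : Fin d => EuclideanSpace ℂ (Fin n)) η.symm).toLinearMap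

theorem permuteTensor_tprod {d n : ℕ} (η : Equiv.Perm (Fin d))
    (x : Fin d → EuclideanSpace ℂ (Fin n)) :
    permuteTensor η (PiTensorProduct.tprod ℂ x) =
      PiTensorProduct.tprod ℂ (fun i => x (η i)) := by
  simp [permuteTensor]

/-- A tensor is symmetric if it is invariant under all permutations of the factors. -/
def IsSymmTensor {d n : ℕ} (w : Tensor d n) : Prop :=
  ∀ η : Equiv.Perm (Fin d), permuteTensor η w = w

/-- The symmetrization operator `σ`. -/
def symmetrization {d n : ℕ} : Tensor d n →ₗ[ℂ] Tensor d n :=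
  ((d.factorial : ℂ)⁻¹) • ∑ η : Equiv.Perm (Fin d), permuteTensor η

theorem symmetrization_tprod {d n : ℕ} (x : Fin d → EuclideanSpace ℂ (Fin n)) :
    symmetrization (PiTensorProduct.tprod ℂ x) =
      ((d.factorial : ℂ)⁻¹) • ∑ η : Equiv.Perm (Fin d),
        PiTensorProduct.tprod ℂ (fun i => x (η i)) := by
  simp [symmetrization, permuteTensor_tprod]

/-- The projective tensor norm: the infimum of `∑ i, ‖z i 1‖ ⋯ ‖z i d‖` over all representations
of the tensor as a finite sum of elementary tensors. -/
def projNorm {d n : ℕ} (w : Tensor d n) : ℝ :=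
  sInf {s : ℝ | ∃ (r : ℕ) (z : Fin r → Fin d → EuclideanSpace ℂ (Fin n)),
    w = ∑ i, PiTensorProduct.tprod ℂ (z i) ∧ s = ∑ i, ∏ j, ‖z i j‖}

end

/-! Suppose `projNorm (symmetrization w) ≥ projNorm w`. By compactness `w` has an optimal
decomposition: `projNorm w` times a convex combination, with positive weights, of elementary tensors
of vectors in the unit ball. A norming functional `f` of `symmetrization w` yields the symmetric
`d`-linear form `T = f ∘ symmetrization ∘ tprod`, of norm at most one. Averaging leaves no slack, so
`T = 1` at every term and all vectors are unit.

It remains to see that the entries of a unit maximizer are proportional when `d > 2`; each term,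
hence `w`, is then symmetric. Freezing all but three entries reduces this to a trilinear `B` with `B
x y z = 1`. Equality in Cauchy–Schwarz gives `B x y u = ⟪z, u⟫`, then determines `B x x u`;
comparing the roles of `y` and `z` gives `⟪x, y⟫ • z = ⟪x, z⟫ • y` (`inner_smul_eq`). -/

open Function Finset Filter Topology
open scoped ComplexInnerProductSpace

/-! ### Maximizers of symmetric trilinear forms -/

section Trilinear

variable {E : Type*} [NormedAddCommGroup E] [InnerProductSpace ℂ E]

/-- A linear functional of norm at most `C` attaining the value `C` at a unit vector `z` is
`C • ⟪z, ·⟫`. -/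
theorem LinearMap.eq_mul_inner_of_bound_of_apply_eq [CompleteSpace E] (l : E →ₗ[ℂ] ℂ) {C : ℝ} (hC : 0 ≤ C) {z : E}
    (hz : ‖z‖ = 1) (hl : ∀ u, ‖l u‖ ≤ C * ‖u‖) (h : l z = C) (u : E) : l u = C * ⟪z, u⟫ := by
  set L := l.mkContinuous C hl
  obtain ⟨a, ha⟩ := (InnerProductSpace.toDual ℂ E).surjective L
  have hla : ∀ u, l u = ⟪a, u⟫ := fun u => by
    rw [← InnerProductSpace.toDual_apply_apply, ha]; rfl
  have hna : ‖a‖ ≤ C := by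
    have : ‖a‖ = ‖L‖ := by rw [← ha, LinearIsometryEquiv.norm_map]
    rw [this]
    exact LinearMap.mkContinuous_norm_le _ hC _
  have hz' : ⟪a, z⟫ = (C : ℂ) := by rw [← hla, h]
  -- Expanding gives `‖a‖² - 2C² + C²`, and `‖a‖ ≤ C`.
  have key : ‖a - (C : ℂ) • z‖ ^ 2 ≤ 0 := by
    rw [@norm_sub_sq ℂ, inner_smul_right, hz', norm_smul, hz]
    simp only [Complex.norm_real, Real.norm_eq_abs, mul_one, sq_abs]
    have : RCLike.re ((C : ℂ) * C) = C * C := by simp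
    rw [this]
    nlinarith [norm_nonneg a]
  have hac : a = (C : ℂ) • z := by
    have : ‖a - (C : ℂ) • z‖ = 0 := by
      have := sq_nonneg ‖a - (C : ℂ) • z‖
      exact pow_eq_zero_iff (two_ne_zero) |>.mp (le_antisymm key this)
    exact sub_eq_zero.mp (norm_eq_zero.mp this)
  rw [hla, hac, inner_smul_left]
  simp

/-- A symmetric trilinear form of norm at most one, recorded as a family of functionals. -/
structure IsSymmContraction (B : E → E → E →ₗ[ℂ] ℂ) : Prop where
  swap₁₂ : ∀ a b c, B a b c = B b a c
  swap₂₃ : ∀ a b c, B a b c = B a c b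
  norm_le : ∀ a b c, ‖B a b c‖ ≤ ‖a‖ * ‖b‖ * ‖c‖

namespace IsSymmContraction

variable {B : E → E → E →ₗ[ℂ] ℂ} (hB : IsSymmContraction B)
include hB

theorem add_middle (a b b' c : E) : B a (b + b') c = B a b c + B a b' c := by
  rw [hB.swap₂₃, map_add, hB.swap₂₃ a c b, hB.swap₂₃ a c b']

theorem add_left (a a' b c : E) : B (a + a') b c = B a b c + B a' b c := by
  rw [hB.swap₁₂, hB.add_middle, hB.swap₁₂ b a, hB.swap₁₂ b a']

theorem smul_middle (r : ℂ) (a b c : E) : B a (r • b) c = r * B a b c := by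
  rw [hB.swap₂₃, map_smul, hB.swap₂₃ a c b, smul_eq_mul]

theorem smul_left (r : ℂ) (a b c : E) : B (r • a) b c = r * B a b c := by
  rw [hB.swap₁₂, hB.smul_middle, hB.swap₁₂ b a]

variable [CompleteSpace E] {x y z : E}

theorem apply_eq_inner (hx : ‖x‖ = 1) (hy : ‖y‖ = 1) (hz : ‖z‖ = 1) (h : B x y z = 1) (u : E) :
    B x y u = ⟪z, u⟫ := by
  have := (B x y).eq_mul_inner_of_bound_of_apply_eq zero_le_one hz
    (fun u => by simpa [hx, hy] using hB.norm_le x y u) (by simpa using h) u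
  simpa using this

/-- `B (x + y) (x + y) z` equals `‖x + y‖²`, the maximum the norm bound allows, so the equality case
applies to this functional too. -/
theorem diag_add_diag (hx : ‖x‖ = 1) (hy : ‖y‖ = 1) (hz : ‖z‖ = 1) (h : B x y z = 1) (u : E) :
    B x x u + B y y u = (⟪y, x⟫ + ⟪x, y⟫) * ⟪z, u⟫ := by
  have hexp : ∀ u, B (x + y) (x + y) u = B x x u + B y y u + 2 * B x y u := fun u => by
    rw [hB.add_left, hB.add_middle, hB.add_middle, hB.swap₁₂ y x]; ring
  have hxxz : B x x z = ⟪y, x⟫ := by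
    rw [hB.swap₂₃]; exact hB.apply_eq_inner hx hz hy (by rw [hB.swap₂₃, h]) x
  have hyyz : B y y z = ⟪x, y⟫ := by
    rw [hB.swap₂₃]
    exact hB.apply_eq_inner hy hz hx (by rw [hB.swap₂₃, hB.swap₁₂, h]) y
  have hnorm : ((‖x + y‖ ^ 2 : ℝ) : ℂ) = ⟪y, x⟫ + ⟪x, y⟫ + 2 := by
    have := inner_self_eq_norm_sq_to_K (𝕜 := ℂ) (x + y)
    refine (Complex.ofReal_pow _ _).trans (this.symm.trans ?_)
    rw [inner_add_left, inner_add_right, inner_add_right, inner_self_eq_norm_sq_to_K (𝕜 := ℂ) x,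
      inner_self_eq_norm_sq_to_K (𝕜 := ℂ) y, hx, hy]
    simp; ring
  have := (B (x + y) (x + y)).eq_mul_inner_of_bound_of_apply_eq (sq_nonneg ‖x + y‖) hz
    (fun u => by simpa [sq] using hB.norm_le (x + y) (x + y) u)
    (by rw [hexp, hxxz, hyyz, h, hnorm]; ring) u
  rw [hexp, hB.apply_eq_inner hx hy hz h, hnorm] at this
  linear_combination this

/-- Replacing `(x, z)` by `(I • x, -I • z)` keeps the value 1 but flips the sign of `B x x`;
subtracting the two instances of `diag_add_diag` isolates it. -/
theorem diag_eq (hx : ‖x‖ = 1) (hy : ‖y‖ = 1) (hz : ‖z‖ = 1) (h : B x y z = 1) (u : E) :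
    B x x u = ⟪y, x⟫ * ⟪z, u⟫ := by
  have h₁ := hB.diag_add_diag hx hy hz h u
  have h₂ := hB.diag_add_diag (x := Complex.I • x) (y := y) (z := (-Complex.I) • z)
    (by simp [norm_smul, hx]) hy (by simp [norm_smul, hz])
    (by
      rw [hB.smul_left, map_smul, h, smul_eq_mul, mul_one, mul_neg, Complex.I_mul_I, neg_neg]) u
  rw [hB.smul_left, hB.smul_middle, inner_smul_left, inner_smul_left, inner_smul_right,
    map_neg, Complex.conj_I] at h₂
  have hI := Complex.I_mul_I
  linear_combination (1 / 2) * h₁ - (1 / 2) * h₂ +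
    (1 / 2) * (B x x u - ⟪y, x⟫ * ⟪z, u⟫ + ⟪x, y⟫ * ⟪z, u⟫) * hI

theorem inner_smul_eq (hx : ‖x‖ = 1) (hy : ‖y‖ = 1) (hz : ‖z‖ = 1) (h : B x y z = 1) :
    ⟪x, y⟫ • z = ⟪x, z⟫ • y := by
  refine ext_inner_right ℂ fun u => ?_
  rw [inner_smul_left, inner_smul_left, inner_conj_symm, inner_conj_symm,
    ← hB.diag_eq hx hy hz h, ← hB.diag_eq hx hz hy (by rw [hB.swap₂₃, h])]

theorem exists_smul_eq_of_inner_ne_zero (hx : ‖x‖ = 1) (hy : ‖y‖ = 1) (hz : ‖z‖ = 1)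
    (h : B x y z = 1) (hxy : ⟪x, y⟫ ≠ 0) : ∃ c : ℂ, z = c • y :=
  ⟨⟪x, y⟫⁻¹ * ⟪x, z⟫, by
    rw [mul_smul, ← hB.inner_smul_eq hx hy hz h, smul_smul, inv_mul_cancel₀ hxy, one_smul]⟩

/-- Two entries of a unit maximizer of a symmetric trilinear form are proportional. -/
theorem exists_smul_eq (hx : ‖x‖ = 1) (hy : ‖y‖ = 1) (hz : ‖z‖ = 1) (h : B x y z = 1) :
    ∃ c : ℂ, y = c • x := by
  have hyxz : B y x z = 1 := by rw [hB.swap₁₂, h]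
  have hxzy : B x z y = 1 := by rw [hB.swap₂₃, h]
  have hzxy : B z x y = 1 := by rw [hB.swap₁₂, hxzy]
  have hzyx : B z y x = 1 := by rw [hB.swap₂₃, hzxy]
  by_cases hxz : ⟪x, z⟫ = 0
  swap
  · exact hB.exists_smul_eq_of_inner_ne_zero hz hx hy hzxy (by rwa [Ne, inner_eq_zero_symm])
  by_cases hyz : ⟪y, z⟫ = 0
  swap
  · obtain ⟨c, hc⟩ := hB.exists_smul_eq_of_inner_ne_zero hz hy hx hzyx
      (by rwa [Ne, inner_eq_zero_symm])
    have hc0 : c ≠ 0 := by rintro rfl; simp [hc] at hx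
    exact ⟨c⁻¹, by rw [hc, smul_smul, inv_mul_cancel₀ hc0, one_smul]⟩
  by_cases hxy : ⟪x, y⟫ = 0
  swap
  · have := hB.inner_smul_eq hx hy hz h
    rw [hxz, zero_smul, smul_eq_zero] at this
    rcases this with h0 | h0
    · exact absurd h0 hxy
    · simp [h0] at hz
  exfalso
  have hyx : ⟪y, x⟫ = 0 := inner_eq_zero_symm.mp hxy
  -- With `x, y, z` pairwise orthogonal, `(v, v, z)` is again a unit maximizer. As `⟪v, v⟫ ≠ 0`, `z`
  -- is a multiple of `v`, yet orthogonal to it.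
  set v : E := ((√2 : ℝ) : ℂ)⁻¹ • (x + y) with hv
  have h2 : ((√2 : ℝ) : ℂ)⁻¹ * ((√2 : ℝ) : ℂ)⁻¹ = 1 / 2 := by
    rw [← mul_inv, ← Complex.ofReal_mul, Real.mul_self_sqrt zero_le_two]; norm_num
  have hnv : ‖v‖ = 1 := by
    have hs : ‖x + y‖ * ‖x + y‖ = 2 := by
      rw [norm_add_sq_eq_norm_sq_add_norm_sq_of_inner_eq_zero x y hxy, hx, hy]; norm_num
    have : ‖x + y‖ = √2 := by
      rw [← hs, Real.sqrt_mul_self (norm_nonneg _)]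
    rw [hv, norm_smul, this, norm_inv, Complex.norm_real, Real.norm_of_nonneg (Real.sqrt_nonneg _)]
    exact inv_mul_cancel₀ (by positivity)
  have hvvz : B v v z = 1 := by
    have := hB.diag_add_diag hx hy hz h z
    rw [hxy, hyx, add_zero, zero_mul] at this
    rw [hv, hB.smul_left, hB.smul_middle, ← mul_assoc, h2, hB.add_left, hB.add_middle,
      hB.add_middle, hyxz, h]
    linear_combination (1 / 2) * this
  obtain ⟨c, hc⟩ := hB.exists_smul_eq_of_inner_ne_zero hnv hnv hz hvvz
    (by rw [inner_self_eq_norm_sq_to_K, hnv]; simp)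
  have hvz : ⟪v, z⟫ = 0 := by
    rw [hv, inner_smul_left, inner_add_left, hxz, hyz]; simp
  rw [hc, inner_smul_right, inner_self_eq_norm_sq_to_K, hnv] at hvz
  have : c = 0 := by simpa using hvz
  simp [hc, this] at hz

end IsSymmContraction

end Trilinear

/-! ### Maximizers of symmetric multilinear forms -/

section Multilinear

variable {E : Type*} [NormedAddCommGroup E] [InnerProductSpace ℂ E]
  {d : ℕ}

theorem prod_norm_update₃ {F : Type*} [NormedAddCommGroup F] {z : Fin d → F} (hz : ∀ m, ‖z m‖ = 1) {i j k : Fin d} (hij : i ≠ j)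
    (hik : i ≠ k) (hjk : j ≠ k) (a b c : F) :
    ∏ m, ‖update (update (update z i a) j b) k c m‖ = ‖a‖ * ‖b‖ * ‖c‖ := by
  have : ∀ m, ‖update (update (update z i a) j b) k c m‖ =
      (if m = i then ‖a‖ else 1) * (if m = j then ‖b‖ else 1) * (if m = k then ‖c‖ else 1) := by
    intro m
    simp only [update_apply]
    split_ifs <;> simp_all
  simp_rw [this, Finset.prod_mul_distrib]
  simp

theorem MultilinearMap.isSymmContraction_update
    (T : MultilinearMap ℂ (fun _ : Fin d => E) ℂ)
    (hsymm : ∀ (η : Equiv.Perm (Fin d)) (z : Fin d → E), T (fun i => z (η i)) = T z)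
    (hT : ∀ z, ‖T z‖ ≤ ∏ i, ‖z i‖) {z : Fin d → E} (hz : ∀ m, ‖z m‖ = 1) {i j k : Fin d}
    (hij : i ≠ j) (hik : i ≠ k) (hjk : j ≠ k) :
    IsSymmContraction fun a b => T.toLinearMap (update (update z i a) j b) k where
  swap₁₂ a b c := by
    simp only [MultilinearMap.toLinearMap_apply]
    rw [← hsymm (Equiv.swap i j)]
    congr 1
    funext m
    simp only [update_apply, Equiv.swap_apply_def]
    split_ifs <;> simp_all
  swap₂₃ a b c := by
    simp only [MultilinearMap.toLinearMap_apply]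
    rw [← hsymm (Equiv.swap j k)]
    congr 1
    funext m
    simp only [update_apply, Equiv.swap_apply_def]
    split_ifs <;> simp_all
  norm_le a b c := by
    simp only [MultilinearMap.toLinearMap_apply]
    exact (hT _).trans_eq (prod_norm_update₃ hz hij hik hjk a b c)

/-- For `d > 2`, the entries of a unit maximizer of a symmetric `d`-linear form of norm at most
one on a complex Hilbert space are pairwise proportional. -/
theorem MultilinearMap.exists_smul_eq_of_apply_eq_one [CompleteSpace E] (hd : 2 < d)
    (T : MultilinearMap ℂ (fun _ : Fin d => E) ℂ)
    (hsymm : ∀ (η : Equiv.Perm (Fin d)) (z : Fin d → E), T (fun i => z (η i)) = T z)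
    (hT : ∀ z, ‖T z‖ ≤ ∏ i, ‖z i‖) {z : Fin d → E} (hz : ∀ m, ‖z m‖ = 1) (h : T z = 1)
    (i j : Fin d) : ∃ c : ℂ, z j = c • z i := by
  by_cases hij : i = j
  · exact ⟨1, by simp [hij]⟩
  -- A third slot is essential: the bilinear form `x₁y₁ + x₂y₂` is maximal at `(1, i)/√2`, `(1,
  -- -i)/√2`.
  obtain ⟨k, hk⟩ : ∃ k, k ∉ ({i, j} : Finset (Fin d)) := by
    by_contra! hall
    have : Finset.univ ⊆ ({i, j} : Finset (Fin d)) := fun k _ => hall k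
    have := (Finset.card_le_card this).trans Finset.card_le_two
    simp at this
    omega
  simp only [Finset.mem_insert, Finset.mem_singleton, not_or] at hk
  have hB := T.isSymmContraction_update hsymm hT hz hij (Ne.symm hk.1) (Ne.symm hk.2)
  exact hB.exists_smul_eq (hz i) (hz j) (hz k) (by simp [h])

end Multilinear

/-! ### Compactness of the convex hull -/

/-- In a finite-dimensional space the convex hull of a compact set is compact. -/
theorem IsCompact.convexHull_of_finiteDimensional {F : Type*} [AddCommGroup F] [Module ℝ F]
    [TopologicalSpace F] [ContinuousAdd F] [ContinuousSMul ℝ F] [FiniteDimensional ℝ F]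
    {s : Set F} (hs : IsCompact s) : IsCompact (convexHull ℝ s) := by
  -- By Carathéodory, the hull is a finite union of continuous images of compact sets.
  have heq : convexHull ℝ s = ⋃ m ∈ {m : ℕ | m ≤ Module.finrank ℝ F + 1},
      (fun p : (Fin m → ℝ) × (Fin m → F) => ∑ i, p.1 i • p.2 i) ''
        (stdSimplex ℝ (Fin m) ×ˢ Set.univ.pi fun _ => s) := by
    apply Set.Subset.antisymm
    · intro x hx
      obtain ⟨ι, _, z, w, hz, hind, hw, hw1, hx⟩ := eq_pos_convex_span_of_mem_convexHull hx
      have hcard : Fintype.card ι ≤ Module.finrank ℝ F + 1 :=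
        hind.card_le_finrank_succ.trans
          (Nat.succ_le_succ (Submodule.finrank_le _))
      let e := (Fintype.equivFin ι).symm
      refine Set.mem_biUnion hcard ⟨(w ∘ e, z ∘ e), ⟨⟨fun i => (hw _).le, ?_⟩, ?_⟩, ?_⟩
      · exact (Equiv.sum_comp e w).trans hw1
      · exact fun i _ => hz ⟨_, rfl⟩
      · exact (Equiv.sum_comp e fun i => w i • z i).trans hx
    · refine Set.iUnion₂_subset fun m _ => ?_
      rintro _ ⟨⟨w, z⟩, ⟨hw, hz⟩, rfl⟩
      exact (convex_convexHull ℝ s).sum_mem (fun i _ => hw.1 i) hw.2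
        fun i _ => subset_convexHull ℝ s (hz i trivial)
  rw [heq]
  refine (Set.finite_le_nat _).isCompact_biUnion fun m _ => ?_
  refine ((isCompact_stdSimplex ℝ (Fin m)).prod (isCompact_univ_pi fun _ => hs)).image ?_
  fun_prop

/-! ### Optimal decompositions for the projective norm -/

section ProjNorm

variable {d n : ℕ}

theorem bddBelow_projNorm (w : Tensor d n) :
    BddBelow {s : ℝ | ∃ (r : ℕ) (z : Fin r → Fin d → EuclideanSpace ℂ (Fin n)),
      w = ∑ i, PiTensorProduct.tprod ℂ (z i) ∧ s = ∑ i, ∏ j, ‖z i j‖} := by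
  refine ⟨0, ?_⟩
  rintro _ ⟨r, z, -, rfl⟩
  positivity

/-- Absorbs into one factor the scalar coefficients that `PiTensorProduct.lifts` carries and
`projNorm` does not. -/
theorem exists_tprod_eq_smul_tprod (hd : 0 < d) (a : ℂ)
    (m : Fin d → EuclideanSpace ℂ (Fin n)) :
    ∃ m' : Fin d → EuclideanSpace ℂ (Fin n),
      PiTensorProduct.tprod ℂ m' = a • PiTensorProduct.tprod ℂ m ∧
        ∏ j, ‖m' j‖ = ‖a‖ * ∏ j, ‖m j‖ := by
  refine ⟨update m ⟨0, hd⟩ (a • m ⟨0, hd⟩), by rw [MultilinearMap.map_update_smul]; simp, ?_⟩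
  have : ∀ j, ‖update m ⟨0, hd⟩ (a • m ⟨0, hd⟩) j‖ =
      (if j = ⟨0, hd⟩ then ‖a‖ else 1) * ‖m j‖ := by
    intro j
    simp only [update_apply]
    split_ifs with h
    · rw [norm_smul, h]
    · simp
  simp_rw [this, Finset.prod_mul_distrib]
  simp

theorem exists_eq_sum_tprod_of_mem_lifts (hd : 0 < d) {w : Tensor d n}
    {p : FreeAddMonoid (ℂ × (Fin d → EuclideanSpace ℂ (Fin n)))}
    (hp : p ∈ PiTensorProduct.lifts w) :
    ∃ (r : ℕ) (z : Fin r → Fin d → EuclideanSpace ℂ (Fin n)),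
      w = ∑ i, PiTensorProduct.tprod ℂ (z i) ∧
        PiTensorProduct.projectiveSeminormAux p = ∑ i, ∏ j, ‖z i j‖ := by
  rw [PiTensorProduct.mem_lifts_iff] at hp
  choose z hz hz' using fun q : ℂ × (Fin d → EuclideanSpace ℂ (Fin n)) =>
    exists_tprod_eq_smul_tprod hd q.1 q.2
  refine ⟨p.toList.length, fun i => z p.toList[i], ?_, ?_⟩
  · simp only [hz]
    rw [← hp]
    exact (Fin.sum_univ_fun_getElem _ _).symm
  · simp only [hz']
    exact (Fin.sum_univ_fun_getElem _ _).symm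

/-- This inequality lets a functional norming for `‖·‖` bound `projNorm`. -/
theorem projNorm_le_norm (hd : 0 < d) (w : Tensor d n) : projNorm w ≤ ‖w‖ := by
  rw [PiTensorProduct.norm_def]
  have : Nonempty (PiTensorProduct.lifts w) := (PiTensorProduct.nonempty_lifts w).to_subtype
  exact le_ciInf fun ⟨p, hp⟩ =>
    csInf_le (bddBelow_projNorm w) (exists_eq_sum_tprod_of_mem_lifts hd hp)

theorem projNorm_nonneg (w : Tensor d n) : 0 ≤ projNorm w := by
  apply Real.sInf_nonneg
  rintro _ ⟨r, z, -, rfl⟩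
  positivity

theorem nonempty_projNorm (hd : 0 < d) (w : Tensor d n) :
    {s : ℝ | ∃ (r : ℕ) (z : Fin r → Fin d → EuclideanSpace ℂ (Fin n)),
      w = ∑ i, PiTensorProduct.tprod ℂ (z i) ∧ s = ∑ i, ∏ j, ‖z i j‖}.Nonempty :=
  let ⟨_, hp⟩ := PiTensorProduct.nonempty_lifts w
  ⟨_, exists_eq_sum_tprod_of_mem_lifts hd hp⟩

/-- The elementary tensors of vectors in the closed unit ball. -/
def unitTensors (d n : ℕ) : Set (Tensor d n) :=
  PiTensorProduct.tprod ℂ '' {z | ∀ i, ‖z i‖ ≤ 1}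

theorem zero_mem_unitTensors (hd : 0 < d) : (0 : Tensor d n) ∈ unitTensors d n :=
  ⟨0, by simp, MultilinearMap.map_coord_zero _ ⟨0, hd⟩ rfl⟩

theorem exists_tprod_eq_smul_unitTensors (z : Fin d → EuclideanSpace ℂ (Fin n)) :
    ∃ p ∈ unitTensors d n, PiTensorProduct.tprod ℂ z = (∏ j, ‖z j‖) • p := by
  refine ⟨PiTensorProduct.tprod ℂ fun j => ((‖z j‖ : ℂ)⁻¹ • z j), ⟨_, fun j => ?_, rfl⟩, ?_⟩
  · rw [norm_smul, norm_inv, Complex.norm_real, norm_norm]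
    exact inv_mul_le_one
  · have : z = fun j => (‖z j‖ : ℂ) • ((‖z j‖ : ℂ)⁻¹ • z j) := by
      funext j
      by_cases h : z j = 0
      · simp [h]
      · rw [smul_smul, mul_inv_cancel₀ (by simpa using h), one_smul]
    conv_lhs => rw [this, MultilinearMap.map_smul_univ]
    rw [← Complex.ofReal_prod, Complex.coe_smul]

theorem exists_mem_convexHull_of_projNorm_lt (hd : 0 < d) {w : Tensor d n} {s : ℝ}
    (hs : projNorm w < s) : ∃ p ∈ convexHull ℝ (unitTensors d n), w = s • p := by
  obtain ⟨_, ⟨r, z, hw, rfl⟩, hlt⟩ := exists_lt_of_csInf_lt (nonempty_projNorm hd w) hs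
  have hs0 : 0 < s := (projNorm_nonneg w).trans_lt hs
  have h0 := subset_convexHull ℝ _ (zero_mem_unitTensors (n := n) hd)
  choose p hp hpz using fun i => exists_tprod_eq_smul_unitTensors (z i)
  simp only [hpz] at hw
  set c : Fin r → ℝ := fun i => ∏ j, ‖z i j‖
  have hc : ∀ i, 0 ≤ c i := fun i => by positivity
  refine ⟨s⁻¹ • w, ?_, by rw [smul_smul, mul_inv_cancel₀ hs0.ne', one_smul]⟩
  rcases (Finset.sum_nonneg fun i _ => hc i).eq_or_lt with hsum | hsum
  · have : ∀ i, c i = 0 := fun i =>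
      (Finset.sum_eq_zero_iff_of_nonneg fun i _ => hc i).mp hsum.symm i (Finset.mem_univ i)
    simpa [hw, c, this] using h0
  · have hmem : (∑ i, c i)⁻¹ • w ∈ convexHull ℝ (unitTensors d n) := by
      rw [hw, Finset.smul_sum]
      simp only [smul_smul]
      refine (convex_convexHull ℝ _).sum_mem (fun i _ => mul_nonneg (inv_nonneg.mpr hsum.le) (hc i))
        ?_ fun i _ => subset_convexHull ℝ _ (hp i)
      rw [← Finset.mul_sum, inv_mul_cancel₀ hsum.ne']
    -- The total weight may be below `s`; shrinking towards 0 stays in the hull.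
    have := (convex_convexHull ℝ (unitTensors d n)).smul_mem_of_zero_mem h0 hmem
      (t := s⁻¹ * ∑ i, c i)
      ⟨by positivity, by rw [inv_mul_le_iff₀ hs0, mul_one]; exact hlt.le⟩
    rwa [smul_smul, mul_assoc, mul_inv_cancel₀ hsum.ne', mul_one] at this

/-- The coordinates of a tensor in the standard basis. -/
noncomputable def tensorCoord (d n : ℕ) : Tensor d n ≃ₗ[ℂ] ((Fin d → Fin n) → ℂ) :=
  (Basis.piTensorProduct fun _ : Fin d => (EuclideanSpace.basisFun (Fin n) ℂ).toBasis).equivFun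

theorem tensorCoord_tprod (z : Fin d → EuclideanSpace ℂ (Fin n)) (p : Fin d → Fin n) :
    tensorCoord d n (PiTensorProduct.tprod ℂ z) p = ∏ i, z i (p i) := by
  simp [tensorCoord]

theorem isCompact_tensorCoord_image_unitTensors :
    IsCompact (tensorCoord d n '' unitTensors d n) := by
  rw [unitTensors, Set.image_image]
  have hset : {z : Fin d → EuclideanSpace ℂ (Fin n) | ∀ i, ‖z i‖ ≤ 1} =
      Set.univ.pi fun _ => Metric.closedBall 0 1 := by
    ext z; simp
  rw [hset]
  refine (isCompact_univ_pi fun _ => isCompact_closedBall _ _).image ?_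
  refine continuous_pi fun p => ?_
  simp only [tensorCoord_tprod]
  fun_prop

/-- The infimum defining the projective norm is attained. -/
theorem exists_mem_convexHull_eq_projNorm_smul (hd : 0 < d) (w : Tensor d n) :
    ∃ p ∈ convexHull ℝ (unitTensors d n), w = projNorm w • p := by
  have hK := (isCompact_tensorCoord_image_unitTensors (d := d) (n := n)).convexHull_of_finiteDimensional
  let e : Tensor d n ≃ₗ[ℝ] ((Fin d → Fin n) → ℂ) := (tensorCoord d n).restrictScalars ℝ
  have himg : convexHull ℝ (tensorCoord d n '' unitTensors d n) =
      e '' convexHull ℝ (unitTensors d n) :=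
    (e.toLinearMap.image_convexHull _).symm
  rw [himg] at hK
  -- Near-optimal hull points subconverge in coordinates while their scale factors tend to `projNorm
  -- w`.
  have hlt : ∀ k : ℕ, projNorm w < projNorm w + 1 / ((k : ℝ) + 1) := fun k =>
    lt_add_of_pos_right _ Nat.one_div_pos_of_nat
  choose p hp hwp using fun k => exists_mem_convexHull_of_projNorm_lt hd (hlt k)
  obtain ⟨_, ⟨q, hq, rfl⟩, φ, hφ, hlim⟩ := hK.tendsto_subseq fun k => Set.mem_image_of_mem e (hp k)
  refine ⟨q, hq, e.injective ?_⟩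
  have h1 : Tendsto (fun k => projNorm w + 1 / (((φ k : ℕ) : ℝ) + 1)) atTop
      (𝓝 (projNorm w + 0)) :=
    tendsto_const_nhds.add (tendsto_one_div_add_atTop_nhds_zero_nat.comp hφ.tendsto_atTop)
  have h2 := h1.smul hlim
  have h3 : ∀ k, (projNorm w + 1 / (((φ k : ℕ) : ℝ) + 1)) • (e ∘ p) (φ k) = e w := fun k => by
    conv_rhs => rw [hwp (φ k)]
    rw [map_smul]; rfl
  rw [map_smul]
  have h4 := tendsto_nhds_unique (h2.congr fun k => h3 k) tendsto_const_nhds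
  simpa using h4.symm

end ProjNorm

/-! ### Symmetrization -/

section Symmetrization

variable {d n : ℕ}

theorem symmetrization_tprod_comp_perm (τ : Equiv.Perm (Fin d))
    (z : Fin d → EuclideanSpace ℂ (Fin n)) :
    symmetrization (PiTensorProduct.tprod ℂ fun i => z (τ i)) =
      symmetrization (PiTensorProduct.tprod ℂ z) := by
  rw [symmetrization_tprod, symmetrization_tprod]
  congr 1
  exact Equiv.sum_comp (Equiv.mulLeft τ)
    fun η : Equiv.Perm (Fin d) => PiTensorProduct.tprod ℂ fun i => z (η i)

theorem norm_symmetrization_tprod_le (z : Fin d → EuclideanSpace ℂ (Fin n)) :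
    ‖symmetrization (PiTensorProduct.tprod ℂ z)‖ ≤ ∏ i, ‖z i‖ := by
  rw [symmetrization_tprod, norm_smul, norm_inv, Complex.norm_natCast,
    inv_mul_le_iff₀ (by positivity)]
  refine (norm_sum_le _ _).trans ?_
  have : ∀ η ∈ (Finset.univ : Finset (Equiv.Perm (Fin d))),
      ‖PiTensorProduct.tprod ℂ fun i => z (η i)‖ ≤ ∏ i, ‖z i‖ := fun η _ =>
    (PiTensorProduct.projectiveSeminorm_tprod_le _).trans_eq (Equiv.prod_comp η fun i => ‖z i‖)
  refine (Finset.sum_le_card_nsmul _ _ _ this).trans_eq ?_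
  simp [Finset.card_univ, Fintype.card_perm]

theorem isSymmTensor_tprod_of_proportional (hd : 0 < d)
    {z : Fin d → EuclideanSpace ℂ (Fin n)} (hz : ∀ i j, ∃ c : ℂ, z j = c • z i) :
    IsSymmTensor (PiTensorProduct.tprod ℂ z) := by
  intro η
  choose c hc using hz ⟨0, hd⟩
  have : z = fun j => c j • z ⟨0, hd⟩ := funext hc
  have h : PiTensorProduct.tprod ℂ z =
      (∏ j, c j) • PiTensorProduct.tprod ℂ fun _ : Fin d => z ⟨0, hd⟩ := by
    conv_lhs => rw [this]
    exact MultilinearMap.map_smul_univ _ c fun _ : Fin d => z ⟨0, hd⟩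
  rw [h, map_smul, permuteTensor_tprod]

theorem isSymmTensor_sum {ι : Type*} {s : Finset ι} {w : ι → Tensor d n}
    (h : ∀ i ∈ s, IsSymmTensor (w i)) : IsSymmTensor (∑ i ∈ s, w i) := fun η => by
  rw [map_sum]
  exact Finset.sum_congr rfl fun i hi => h i hi η

theorem IsSymmTensor.smul {w : Tensor d n} (h : IsSymmTensor w) (c : ℝ) :
    IsSymmTensor (c • w) := fun η => by
  rw [← Complex.coe_smul, map_smul, h η]

end Symmetrization

theorem mainTheorem8 (d n : ℕ) (hd : 2 < d) (w : Tensor d n) (hw : ¬ IsSymmTensor w) :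
    projNorm (symmetrization w) < projNorm w := by
  have hd0 : 0 < d := by omega
  by_contra! hle
  apply hw
  obtain ⟨f, hf, hfw⟩ := exists_dual_vector'' ℂ (symmetrization w)
  let T : MultilinearMap ℂ (fun _ : Fin d => EuclideanSpace ℂ (Fin n)) ℂ :=
    (f.toLinearMap ∘ₗ symmetrization).compMultilinearMap (PiTensorProduct.tprod ℂ)
  have hTapp : ∀ z, T z = f (symmetrization (PiTensorProduct.tprod ℂ z)) := fun z => rfl
  have hT : ∀ z, ‖T z‖ ≤ ∏ i, ‖z i‖ := fun z =>
    ((f.le_of_opNorm_le hf _).trans_eq (one_mul _)).trans (norm_symmetrization_tprod_le z)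
  have hsymm : ∀ (η : Equiv.Perm (Fin d)) z, T (fun i => z (η i)) = T z := fun η z => by
    rw [hTapp, hTapp, symmetrization_tprod_comp_perm]
  obtain ⟨q, hq, hwq⟩ := exists_mem_convexHull_eq_projNorm_smul hd0 w
  rcases (projNorm_nonneg w).eq_or_lt with hM | hM
  · rw [hwq, ← hM, zero_smul]
    exact fun η => map_zero _
  obtain ⟨ι, _, p, c, hp, -, hc, hc1, hqsum⟩ := eq_pos_convex_span_of_mem_convexHull hq
  choose z hz hzp using fun i => hp (Set.mem_range_self i)
  have hre : ∀ i, (T (z i)).re ≤ 1 := fun i =>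
    ((Complex.re_le_norm _).trans (hT _)).trans
      (Finset.prod_le_one (fun _ _ => norm_nonneg _) fun j _ => hz i j)
  have hval : (f (symmetrization w)).re = projNorm w * ∑ i, c i * (T (z i)).re := by
    have : f (symmetrization w) = (projNorm w : ℂ) * ∑ i, (c i : ℂ) * T (z i) := by
      conv_lhs => rw [hwq, ← hqsum]
      simp only [← Complex.coe_smul, map_smul, map_sum, smul_eq_mul, hTapp, hzp]
    rw [this, Complex.re_ofReal_mul, Complex.re_sum]
    simp only [Complex.re_ofReal_mul]
  have hge : projNorm w * 1 ≤ projNorm w * ∑ i, c i * (T (z i)).re := by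
    rw [← hval, hfw, mul_one]
    exact hle.trans (by simpa using projNorm_le_norm hd0 (symmetrization w))
  have hge' : ∑ i, c i ≤ ∑ i, c i * (T (z i)).re := by
    rw [hc1]; exact le_of_mul_le_mul_left hge hM
  -- Positive weights force equality in every term of the average.
  have hone : ∀ i, (T (z i)).re = 1 := by
    have hle' : ∀ i ∈ Finset.univ, c i * (T (z i)).re ≤ c i := fun i _ =>
      mul_le_of_le_one_right (hc i).le (hre i)
    have := (Finset.sum_eq_sum_iff_of_le hle').mp (le_antisymm (Finset.sum_le_sum hle') hge')
    exact fun i => (mul_eq_left₀ (hc i).ne').mp (this i (Finset.mem_univ i))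
  have hnorm : ∀ i j, ‖z i j‖ = 1 := fun i j => by
    refine le_antisymm (hz i j) ?_
    have h1 : 1 ≤ ∏ j, ‖z i j‖ := by
      rw [← hone i]; exact (Complex.re_le_norm _).trans (hT _)
    refine h1.trans ?_
    rw [← Finset.mul_prod_erase _ _ (Finset.mem_univ j)]
    exact mul_le_of_le_one_right (norm_nonneg _)
      (Finset.prod_le_one (fun _ _ => norm_nonneg _) fun k _ => hz i k)
  have hTone : ∀ i, T (z i) = 1 := fun i => by
    have h1 : ‖T (z i)‖ ≤ 1 := (hT _).trans_eq (by simp [hnorm])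
    have h2 : (T (z i)).re = ‖T (z i)‖ :=
      le_antisymm (Complex.re_le_norm _) (h1.trans_eq (hone i).symm)
    have h3 := Complex.re_eq_norm.mp h2
    apply Complex.ext
    · simpa using hone i
    · simpa using (Complex.nonneg_iff.mp h3).2.symm
  rw [hwq, ← hqsum]
  refine (isSymmTensor_sum fun i _ => IsSymmTensor.smul ?_ _).smul _
  rw [← hzp]
  exact isSymmTensor_tprod_of_proportional hd0
    (T.exists_smul_eq_of_apply_eq_one hd hsymm hT (hnorm i) (hTone i))
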